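/- Let $\mathbb F$ be a field. A Leibniz algebra is an $\mathbb F$-vector space $L$ with a bilinear multiplication satisfying $x(yz)=(xy)z+y(xz)$. Write $L'$ for the span of all products, $Z(L)=\{z : zx=xz=0\ \forall x\in L\}$ for the center, and call an ideal $Z$ of $L$ central if $Z\subseteq Z(L)$. For a free presentation $0\to R\to F\xrightarrow{\pi} L\to 0$ ($F$ a free Leibniz algebra, $\pi$ a surjective homomorphism with kernel $R$), the multiplier of $L$ is $$M(L)=\frac{F'\cap R}{FR+RF}.$$ If $L$ is finite-dimensional, $M(L)$ is, equivalently, the ideal $M$ in a maximal defining pair $(K,M)$ of $L$, that is, a pair consisting of a Leibniz algebra $K$ and an ideal $M\subseteq Z(K)\cap K'$ with $K/M\cong L$ such that $\dim K$ is maximal among all such pairs. **Corollary (Stallings sequence).** Let $Z$ be a central ideal of a Leibniz algebra $L$ over $\mathbb F$, with quotient map $q:L\to L/Z$. Let $\pi_1:F_1\to L$ and $\pi_2:F_2\to L/Z$ be free presentations with kernels $R_1,R_2$, and let $\varphi:F_1\to F_2$ and $\psi:F_2\to L$ be homomorphisms with $\pi_2\varphi=q\pi_1$ and $q\psi=\pi_2$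 (such homomorphisms exist). Then the sequence $$M(L)\xrightarrow{\ \beta\ } M(L/Z)\xrightarrow{\ \theta\ } Z\longrightarrow L/L'\longrightarrow \frac{L}{Z+L'}\longrightarrow 0$$ is exact, where $M(L)$ and $M(L/Z)$ are computed from these presentations, $\beta$ sends the class of $x\in F_1'\cap R_1$ to the class of $\varphi(x)$, $\theta$ sends the class of $x\in F_2'\cap R_2$ to $\psi(x)$, and the remaining maps are the natural ones. Moreover, if $L$ is finite-dimensional and $(K_1,M_1)$, $(K_2,M_2)$ are maximal defining pairs of $L$ and $L/Z$, then there are isomorphisms $M_1\cong M(L)$ and $M_2\cong M(L/Z)$ onto the multipliers computed from these presentations, and transporting $\beta$ and $\theta$ along them gives an exact sequence $M_1\to M_2\to Z\to L/L'\to L/(Z+L')\to 0$. -/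

import Mathlib

universe u v

/-- The (left) Leibniz identity `x(yz) = (xy)z + y(xz)`.  A Leibniz algebra over a field `k` is a
`k`-vector space `L` with a bilinear multiplication (`NonUnitalNonAssocRing L`, `Module k L`,
`IsScalarTower k L L`, `SMulCommClass k L L`) satisfying this identity; homomorphisms are the
multiplicative linear maps `L →ₙₐ[k] L'`. -/
class IsLeibniz (L : Type*) [NonUnitalNonAssocRing L] : Prop where
  leibniz : ∀ x y z : L, x * (y * z) = x * y * z + y * (x * z)

/-- A two-sided ideal of a (not necessarily associative) `k`-algebra. -/
structure AlgIdeal (k : Type*) (A : Type*) [Field k] [NonUnitalNonAssocRing A] [Module k A]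
    extends Submodule k A where
  mul_mem_left' : ∀ a x : A, x ∈ carrier → a * x ∈ carrier
  mul_mem_right' : ∀ a x : A, x ∈ carrier → x * a ∈ carrier

namespace AlgIdeal

section Basic

variable {k : Type*} {A : Type*} [Field k] [NonUnitalNonAssocRing A] [Module k A]

theorem mul_mem_left (I : AlgIdeal k A) (a : A) {x : A} (hx : x ∈ I.toSubmodule) :
    a * x ∈ I.toSubmodule := I.mul_mem_left' a x hx

theorem mul_mem_right (I : AlgIdeal k A) (a : A) {x : A} (hx : x ∈ I.toSubmodule) :
    x * a ∈ I.toSubmodule := I.mul_mem_right' a x hx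

/-- The quotient algebra `A / I`. -/
def Quotient (I : AlgIdeal k A) : Type _ := A ⧸ I.toSubmodule

instance (I : AlgIdeal k A) : AddCommGroup I.Quotient :=
  inferInstanceAs (AddCommGroup (A ⧸ I.toSubmodule))

instance (I : AlgIdeal k A) : Module k I.Quotient :=
  inferInstanceAs (Module k (A ⧸ I.toSubmodule))

/-- The quotient map as a linear map. -/
def projₗ (I : AlgIdeal k A) : A →ₗ[k] I.Quotient := I.toSubmodule.mkQ

theorem projₗ_surjective (I : AlgIdeal k A) : Function.Surjective I.projₗ :=
  I.toSubmodule.mkQ_surjective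

theorem projₗ_eq_iff (I : AlgIdeal k A) {x y : A} :
    I.projₗ x = I.projₗ y ↔ x - y ∈ I.toSubmodule :=
  Submodule.Quotient.eq I.toSubmodule

instance (I : AlgIdeal k A) : Mul I.Quotient where
  mul := Quotient.map₂ (· * ·) fun a a' ha b b' hb => by
    have ha' : a - a' ∈ I.toSubmodule := (Submodule.quotientRel_def _).1 ha
    have hb' : b - b' ∈ I.toSubmodule := (Submodule.quotientRel_def _).1 hb
    refine (Submodule.quotientRel_def _).2 ?_
    have h : a * b - a' * b' = (a - a') * b + a' * (b - b') := by
      rw [sub_mul, mul_sub]; abel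
    rw [h]
    exact I.toSubmodule.add_mem (I.mul_mem_right _ ha') (I.mul_mem_left _ hb')

theorem projₗ_mul (I : AlgIdeal k A) (x y : A) : I.projₗ (x * y) = I.projₗ x * I.projₗ y := rfl

instance (I : AlgIdeal k A) : NonUnitalNonAssocRing I.Quotient where
  left_distrib a b c := by
    obtain ⟨a, rfl⟩ := I.projₗ_surjective a
    obtain ⟨b, rfl⟩ := I.projₗ_surjective b
    obtain ⟨c, rfl⟩ := I.projₗ_surjective c
    simp only [← map_add, ← projₗ_mul, mul_add]
  right_distrib a b c := by
    obtain ⟨a, rfl⟩ := I.projₗ_surjective a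
    obtain ⟨b, rfl⟩ := I.projₗ_surjective b
    obtain ⟨c, rfl⟩ := I.projₗ_surjective c
    simp only [← map_add, ← projₗ_mul, add_mul]
  zero_mul a := by
    obtain ⟨a, rfl⟩ := I.projₗ_surjective a
    rw [← map_zero I.projₗ, ← projₗ_mul, zero_mul]
  mul_zero a := by
    obtain ⟨a, rfl⟩ := I.projₗ_surjective a
    rw [← map_zero I.projₗ, ← projₗ_mul, mul_zero]

instance (I : AlgIdeal k A) [IsScalarTower k A A] :
    IsScalarTower k I.Quotient I.Quotient where
  smul_assoc c a b := by
    obtain ⟨a, rfl⟩ := I.projₗ_surjective a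
    obtain ⟨b, rfl⟩ := I.projₗ_surjective b
    simp only [smul_eq_mul, ← map_smul, ← projₗ_mul, smul_mul_assoc]

instance (I : AlgIdeal k A) [SMulCommClass k A A] :
    SMulCommClass k I.Quotient I.Quotient where
  smul_comm c a b := by
    obtain ⟨a, rfl⟩ := I.projₗ_surjective a
    obtain ⟨b, rfl⟩ := I.projₗ_surjective b
    simp only [smul_eq_mul, ← map_smul, ← projₗ_mul, mul_smul_comm]

instance (I : AlgIdeal k A) [IsLeibniz A] : IsLeibniz I.Quotient where
  leibniz a b c := by
    obtain ⟨a, rfl⟩ := I.projₗ_surjective a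
    obtain ⟨b, rfl⟩ := I.projₗ_surjective b
    obtain ⟨c, rfl⟩ := I.projₗ_surjective c
    simp only [← projₗ_mul, ← map_add, IsLeibniz.leibniz a b c]

/-- The quotient homomorphism `A → A / I`. -/
def proj (I : AlgIdeal k A) : A →ₙₐ[k] I.Quotient :=
  { I.projₗ with
    map_zero' := map_zero I.projₗ
    map_mul' := I.projₗ_mul }

theorem proj_surjective (I : AlgIdeal k A) : Function.Surjective I.proj := I.projₗ_surjective

theorem proj_eq_iff (I : AlgIdeal k A) {x y : A} :
    I.proj x = I.proj y ↔ x - y ∈ I.toSubmodule := I.projₗ_eq_iff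

theorem proj_eq_zero_iff (I : AlgIdeal k A) {x : A} : I.proj x = 0 ↔ x ∈ I.toSubmodule := by
  rw [← map_zero I.proj, proj_eq_iff, sub_zero]

end Basic

end AlgIdeal

section Subspaces

variable (k : Type*) (A : Type*) [Field k] [NonUnitalNonAssocRing A] [Module k A]

/-- The derived algebra `A'`: the span of all products. -/
def derivedSubmodule : Submodule k A := Submodule.span k {z | ∃ x y : A, z = x * y}

/-- The (two-sided) center `Z(A) = {z | zx = 0 = xz for all x}`. -/
def centerSubmodule [IsScalarTower k A A] [SMulCommClass k A A] : Submodule k A where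
  carrier := {z | ∀ x : A, z * x = 0 ∧ x * z = 0}
  zero_mem' x := ⟨zero_mul x, mul_zero x⟩
  add_mem' ha hb x := by simp [add_mul, mul_add, ha x, hb x]
  smul_mem' c a ha x := by simp [smul_mul_assoc, mul_smul_comm, ha x]

/-- The ideal of a nonassociative algebra generated by all Leibniz relators
`a(bc) - (ab)c - b(ac)`, as the intersection of all ideals containing them. -/
def leibnizRelators : AlgIdeal k A where
  carrier := {x | ∀ I : AlgIdeal k A,
    (∀ a b c : A, a * (b * c) - (a * b * c + b * (a * c)) ∈ I.toSubmodule) → x ∈ I.toSubmodule}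
  zero_mem' I _ := I.toSubmodule.zero_mem
  add_mem' ha hb I hI := I.toSubmodule.add_mem (ha I hI) (hb I hI)
  smul_mem' c _ ha I hI := I.toSubmodule.smul_mem c (ha I hI)
  mul_mem_left' a _ hx I hI := I.mul_mem_left a (hx I hI)
  mul_mem_right' a _ hx I hI := I.mul_mem_right a (hx I hI)

instance : IsLeibniz (leibnizRelators k A).Quotient where
  leibniz a b c := by
    obtain ⟨a, rfl⟩ := (leibnizRelators k A).projₗ_surjective a
    obtain ⟨b, rfl⟩ := (leibnizRelators k A).projₗ_surjective b
    obtain ⟨c, rfl⟩ := (leibnizRelators k A).projₗ_surjective c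
    simp only [← AlgIdeal.projₗ_mul, ← map_add]
    rw [AlgIdeal.projₗ_eq_iff]
    exact fun I hI => hI a b c

end Subspaces

/-- The free Leibniz algebra on the set `X`: the free nonassociative algebra on `X` modulo the
Leibniz identity. -/
abbrev FreeLeibniz (k : Type*) (X : Type*) [Field k] : Type _ :=
  (leibnizRelators k (FreeNonUnitalNonAssocAlgebra k X)).Quotient

namespace FreeLeibniz

variable {k : Type*} [Field k] {X : Type*}

/-- The inclusion of the generators. -/
noncomputable def of (k : Type*) [Field k] {X : Type*} (x : X) : FreeLeibniz k X :=
  (leibnizRelators k (FreeNonUnitalNonAssocAlgebra k X)).proj (FreeNonUnitalNonAssocAlgebra.of k x)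

variable {L : Type*} [NonUnitalNonAssocRing L] [Module k L] [IsScalarTower k L L]
  [SMulCommClass k L L]

/-- Universal property of the free Leibniz algebra, existence. -/
theorem exists_hom [IsLeibniz L] (f : X → L) :
    ∃ g : FreeLeibniz k X →ₙₐ[k] L, ∀ x, g (of k x) = f x := by
  let h : FreeNonUnitalNonAssocAlgebra k X →ₙₐ[k] L := FreeNonUnitalNonAssocAlgebra.lift k f
  let J : AlgIdeal k (FreeNonUnitalNonAssocAlgebra k X) :=
    { LinearMap.ker (h : FreeNonUnitalNonAssocAlgebra k X →ₗ[k] L) with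
      mul_mem_left' := fun a x hx => by
        have hx' : h x = 0 := hx
        change h (a * x) = 0
        rw [map_mul, hx', mul_zero]
      mul_mem_right' := fun a x hx => by
        have hx' : h x = 0 := hx
        change h (x * a) = 0
        rw [map_mul, hx', zero_mul] }
  have hJ : (leibnizRelators k (FreeNonUnitalNonAssocAlgebra k X)).toSubmodule ≤
      LinearMap.ker (h : FreeNonUnitalNonAssocAlgebra k X →ₗ[k] L) := fun x hx => by
    refine hx J fun a b c => ?_
    change h _ = 0
    simp only [map_sub, map_add, map_mul]
    rw [IsLeibniz.leibniz (h a), sub_self]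
  let g₀ := Submodule.liftQ _ (h : FreeNonUnitalNonAssocAlgebra k X →ₗ[k] L) hJ
  refine ⟨{ g₀ with
    map_zero' := map_zero g₀
    map_mul' := fun a b => ?_ }, fun x => ?_⟩
  · obtain ⟨a, rfl⟩ := AlgIdeal.projₗ_surjective _ a
    obtain ⟨b, rfl⟩ := AlgIdeal.projₗ_surjective _ b
    exact map_mul h a b
  · exact FreeNonUnitalNonAssocAlgebra.lift_of_apply k f x

/-- Universal property of the free Leibniz algebra, uniqueness. -/
theorem hom_ext {g₁ g₂ : FreeLeibniz k X →ₙₐ[k] L} (h : ∀ x, g₁ (of k x) = g₂ (of k x)) :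
    g₁ = g₂ := by
  have h' : g₁.comp (AlgIdeal.proj _) = g₂.comp (AlgIdeal.proj _) :=
    FreeNonUnitalNonAssocAlgebra.hom_ext k h
  ext a
  obtain ⟨a, rfl⟩ := AlgIdeal.proj_surjective _ a
  exact DFunLike.congr_fun h' a

/-- Free Leibniz algebras are projective: homomorphisms lift along surjections. -/
theorem exists_lift {E : Type*} [NonUnitalNonAssocRing E] [Module k E] [IsScalarTower k E E]
    [SMulCommClass k E E] [IsLeibniz E] (p : E →ₙₐ[k] L) (hp : Function.Surjective p)
    (f : FreeLeibniz k X →ₙₐ[k] L) : ∃ g : FreeLeibniz k X →ₙₐ[k] E, ∀ x, p (g x) = f x := by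
  choose s hs using hp
  obtain ⟨g, hg⟩ := exists_hom (k := k) (fun x : X => s (f (of k x)))
  refine ⟨g, fun x => ?_⟩
  have : p.comp g = f := hom_ext fun x => by
    rw [NonUnitalAlgHom.comp_apply, hg, hs]
  exact DFunLike.congr_fun this x

/-- Every Leibniz algebra has a free presentation. -/
theorem exists_presentation [IsLeibniz L] :
    ∃ p : FreeLeibniz k L →ₙₐ[k] L, Function.Surjective p := by
  obtain ⟨p, hp⟩ := exists_hom (k := k) (id : L → L)
  exact ⟨p, fun x => ⟨_, hp x⟩⟩

end FreeLeibniz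

section Multiplier

variable {k : Type*} [Field k]
variable {F : Type*} [NonUnitalNonAssocRing F] [Module k F]
variable {F₂ : Type*} [NonUnitalNonAssocRing F₂] [Module k F₂]
variable {L : Type*} [NonUnitalNonAssocRing L] [Module k L]
variable {L₂ : Type*} [NonUnitalNonAssocRing L₂] [Module k L₂]

/-- The relation space `R = ker π` of a presentation `π : F → L`. -/
def presKer (π : F →ₙₐ[k] L) : Submodule k F := LinearMap.ker (π : F →ₗ[k] L)

/-- The subspace `FR + RF` of `F`, where `R = ker π`. -/
def presComm (π : F →ₙₐ[k] L) : Submodule k F :=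
  Submodule.span k {z | ∃ x r : F, r ∈ presKer π ∧ (z = x * r ∨ z = r * x)}

/-- The numerator `F' ∩ R`. -/
def presNum (π : F →ₙₐ[k] L) : Submodule k F := derivedSubmodule k F ⊓ presKer π

/-- The multiplier `M(L) = (F' ∩ R) / (FR + RF)` computed from a presentation
`0 → R → F → L → 0`.  (Used for `F` a free Leibniz algebra and `π` surjective.  Note that
`FR + RF ⊆ F' ∩ R`.) -/
abbrev PresMultiplier (π : F →ₙₐ[k] L) : Type _ :=
  ↥(presNum π) ⧸ (presComm π).submoduleOf (presNum π)

theorem presComm_le_presNum (π : F →ₙₐ[k] L) : presComm π ≤ presNum π := by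
  refine Submodule.span_le.2 ?_
  rintro z ⟨x, r, hr, hz⟩
  have hr' : π r = 0 := hr
  rcases hz with rfl | rfl
  · refine ⟨Submodule.subset_span ⟨x, r, rfl⟩, ?_⟩
    change π (x * r) = 0
    rw [map_mul, hr', mul_zero]
  · refine ⟨Submodule.subset_span ⟨r, x, rfl⟩, ?_⟩
    change π (r * x) = 0
    rw [map_mul, hr', zero_mul]

theorem map_mem_derived (φ : F →ₙₐ[k] F₂) {x : F} (hx : x ∈ derivedSubmodule k F) :
    φ x ∈ derivedSubmodule k F₂ := by
  have : derivedSubmodule k F ≤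
      (derivedSubmodule k F₂).comap (φ : F →ₗ[k] F₂) := by
    refine Submodule.span_le.2 ?_
    rintro z ⟨x, y, rfl⟩
    exact Submodule.subset_span ⟨φ x, φ y, map_mul φ x y⟩
  exact this hx

theorem map_mem_presKer {π : F →ₙₐ[k] L} {π₂ : F₂ →ₙₐ[k] L₂} {f : L →ₙₐ[k] L₂}
    {φ : F →ₙₐ[k] F₂} (h : ∀ x, π₂ (φ x) = f (π x)) {x : F} (hx : x ∈ presKer π) :
    φ x ∈ presKer π₂ := by
  have hx' : π x = 0 := hx
  change π₂ (φ x) = 0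
  rw [h, hx', map_zero]

theorem map_mem_presComm {π : F →ₙₐ[k] L} {π₂ : F₂ →ₙₐ[k] L₂} {f : L →ₙₐ[k] L₂}
    {φ : F →ₙₐ[k] F₂} (h : ∀ x, π₂ (φ x) = f (π x)) {x : F} (hx : x ∈ presComm π) :
    φ x ∈ presComm π₂ := by
  have : presComm π ≤ (presComm π₂).comap (φ : F →ₗ[k] F₂) := by
    refine Submodule.span_le.2 ?_
    rintro z ⟨x, r, hr, hz⟩
    refine Submodule.subset_span ⟨φ x, φ r, map_mem_presKer h hr, ?_⟩
    rcases hz with rfl | rfl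
    · exact Or.inl (map_mul φ x r)
    · exact Or.inr (map_mul φ r x)
  exact this hx

/-- The map of multipliers induced by a homomorphism `φ : F → F₂` of presentations covering
`f : L → L₂`; it sends the class of `x ∈ F' ∩ R` to the class of `φ x`. -/
def presMultiplierMap (π : F →ₙₐ[k] L) (π₂ : F₂ →ₙₐ[k] L₂) (f : L →ₙₐ[k] L₂)
    (φ : F →ₙₐ[k] F₂) (h : ∀ x, π₂ (φ x) = f (π x)) :
    PresMultiplier π →ₗ[k] PresMultiplier π₂ :=
  Submodule.mapQ _ _
    ((φ : F →ₗ[k] F₂).restrict (p := presNum π) (q := presNum π₂)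
      fun _ hx => ⟨map_mem_derived φ hx.1, map_mem_presKer h hx.2⟩)
    fun _ hx => map_mem_presComm h hx

theorem presMultiplierMap_mk (π : F →ₙₐ[k] L) (π₂ : F₂ →ₙₐ[k] L₂) (f : L →ₙₐ[k] L₂)
    (φ : F →ₙₐ[k] F₂) (h : ∀ x, π₂ (φ x) = f (π x)) (x : presNum π) :
    presMultiplierMap π π₂ f φ h (Submodule.Quotient.mk x) =
      Submodule.Quotient.mk ⟨φ x, map_mem_derived φ x.2.1, map_mem_presKer h x.2.2⟩ := rfl

variable [IsScalarTower k L L] [SMulCommClass k L L]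

/-- The connecting map `M(L/Z) → Z` for a central ideal `Z` of `L`.  Here `π₂ : F₂ → L/Z` is a
presentation of `L/Z` and `ψ : F₂ → L` is a lift of `π₂`; the class of `x` goes to `ψ x`. -/
def presConnecting (Z : AlgIdeal k L) (hZ : Z.toSubmodule ≤ centerSubmodule k L)
    (π₂ : F₂ →ₙₐ[k] Z.Quotient) (ψ : F₂ →ₙₐ[k] L) (h : ∀ x, Z.proj (ψ x) = π₂ x) :
    PresMultiplier π₂ →ₗ[k] ↥Z.toSubmodule :=
  have hker : ∀ x ∈ presKer π₂, ψ x ∈ Z.toSubmodule := fun x hx =>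
    Z.proj_eq_zero_iff.1 ((h x).trans hx)
  Submodule.liftQ _
    ((ψ : F₂ →ₗ[k] L).restrict (p := presNum π₂) (q := Z.toSubmodule)
      fun x hx => hker x hx.2)
    (by
      have hle : presComm π₂ ≤ LinearMap.ker (ψ : F₂ →ₗ[k] L) := by
        refine Submodule.span_le.2 ?_
        rintro z ⟨x, r, hr, hz⟩
        have hc := hZ (hker r hr) (ψ x)
        change ψ z = 0
        rcases hz with rfl | rfl
        · rw [map_mul]; exact hc.2
        · rw [map_mul]; exact hc.1
      intro x hx
      exact Subtype.ext (hle hx))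

theorem presConnecting_mk (Z : AlgIdeal k L) (hZ : Z.toSubmodule ≤ centerSubmodule k L)
    (π₂ : F₂ →ₙₐ[k] Z.Quotient) (ψ : F₂ →ₙₐ[k] L) (h : ∀ x, Z.proj (ψ x) = π₂ x)
    (x : presNum π₂) :
    (presConnecting Z hZ π₂ ψ h (Submodule.Quotient.mk x) : L) = ψ x := rfl

end Multiplier

section Abelianization

variable {k : Type*} [Field k] {L : Type*} [NonUnitalNonAssocRing L] [Module k L]

/-- The natural map `Z → L / L'`. -/
def centralToAb (Z : AlgIdeal k L) : ↥Z.toSubmodule →ₗ[k] L ⧸ derivedSubmodule k L :=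
  (derivedSubmodule k L).mkQ ∘ₗ Z.toSubmodule.subtype

/-- The natural map `L / L' → L / (Z + L')`. -/
def abToQuot (Z : AlgIdeal k L) :
    (L ⧸ derivedSubmodule k L) →ₗ[k] L ⧸ (Z.toSubmodule ⊔ derivedSubmodule k L) :=
  Submodule.factor le_sup_right

end Abelianization

section DefiningPairs

/-- `(K, M)` is a defining pair for `L`: `M` is an ideal of the Leibniz algebra `K` with
`K / M ≅ L` and `M ⊆ Z(K) ∩ K'`. -/
def IsDefiningPair {k : Type*} [Field k]
    (L : Type*) [NonUnitalNonAssocRing L] [Module k L]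
    (K : Type*) [NonUnitalNonAssocRing K] [Module k K] [IsScalarTower k K K]
    [SMulCommClass k K K] [IsLeibniz K] (M : AlgIdeal k K) : Prop :=
  (∃ e : M.Quotient →ₙₐ[k] L, Function.Bijective e) ∧
    M.toSubmodule ≤ centerSubmodule k K ⊓ derivedSubmodule k K

/-- `(K, M)` is a maximal defining pair for `L`: the dimension of `K` is maximal among all
defining pairs.  For finite-dimensional `L`, the ideal `M` is then the multiplier of `L` and `K` is
a cover of `L`. -/
def IsMaximalDefiningPair {k : Type u} [Field k]
    (L : Type v) [NonUnitalNonAssocRing L] [Module k L]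
    (K : Type (max u v)) [NonUnitalNonAssocRing K] [Module k K] [IsScalarTower k K K]
    [SMulCommClass k K K] [IsLeibniz K] (M : AlgIdeal k K) : Prop :=
  IsDefiningPair L K M ∧
    ∀ (K₂ : Type (max u v)) [NonUnitalNonAssocRing K₂] [Module k K₂] [IsScalarTower k K₂ K₂]
      [SMulCommClass k K₂ K₂] [IsLeibniz K₂] (M₂ : AlgIdeal k K₂),
      IsDefiningPair L K₂ M₂ → Module.rank k K₂ ≤ Module.rank k K

end DefiningPairs

/-! Everything rests on one principle: a product depends only on its factors modulo the center, and
modulo `FR + RF` only on its factors modulo `R`. Hence maps agreeing modulo `Z` agree on derived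
algebras, and an endomorphism of `F₂` over `L/Z` acts trivially on `F₂'` modulo `F₂R₂ + R₂F₂`. At
`M(L/Z)`: `ψφ` and `π₁` agree modulo `Z`, so `θβ = 0`; conversely, if `ψ x = 0`, freeness gives `χ :
F₂ → F₁` with `π₁χ = ψ`, and `φχ` lies over the identity of `L/Z`, so the class of `χ x` maps to
that of `x`. At `Z`: `ψ` is onto modulo `Z`, hence maps `F₂'` onto `L'`. For covers, the ideal of
any defining pair is a quotient of `M(L)`, while killing a complement of `F' ∩ R` in `R` modulo `FR
+ RF` gives a pair whose ideal contains a copy of `M(L)`. Since `dim K = dim L + dim M` with `dim L`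
finite, maximality forces equal dimensions; the resulting isomorphisms transport `β` and `θ`. -/

/-! ### Homomorphisms modulo central subspaces and modulo `FR + RF` -/

section Homomorphisms

variable {k : Type*} [Field k]
variable {A : Type*} [NonUnitalNonAssocRing A] [Module k A]
variable {B : Type*} [NonUnitalNonAssocRing B] [Module k B]

/-- The kernel of a homomorphism, as a two-sided ideal. -/
def AlgIdeal.ker (f : A →ₙₐ[k] B) : AlgIdeal k A :=
  { presKer f with
    mul_mem_left' := fun a x hx => by
      have hx' : f x = 0 := hx
      change f (a * x) = 0
      rw [map_mul, hx', mul_zero]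
    mul_mem_right' := fun a x hx => by
      have hx' : f x = 0 := hx
      change f (x * a) = 0
      rw [map_mul, hx', zero_mul] }

theorem AlgIdeal.mem_ker {f : A →ₙₐ[k] B} {x : A} : x ∈ (AlgIdeal.ker f).toSubmodule ↔ f x = 0 :=
  Iff.rfl

/-- A homomorphism vanishing on an ideal factors through the quotient. -/
theorem AlgIdeal.exists_lift (I : AlgIdeal k A) (f : A →ₙₐ[k] B)
    (h : ∀ x ∈ I.toSubmodule, f x = 0) :
    ∃ g : I.Quotient →ₙₐ[k] B, ∀ x, g (I.proj x) = f x := by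
  let g₀ : I.Quotient →ₗ[k] B := Submodule.liftQ I.toSubmodule (f : A →ₗ[k] B) h
  refine ⟨{ g₀ with
    map_zero' := map_zero g₀
    map_mul' := fun a b => ?_ }, fun x => rfl⟩
  obtain ⟨a, rfl⟩ := I.projₗ_surjective a
  obtain ⟨b, rfl⟩ := I.projₗ_surjective b
  exact map_mul f a b

/-- Two homomorphisms agreeing modulo a central subspace agree on the derived algebra. -/
theorem eq_on_derived_of_sub_mem_center [IsScalarTower k B B] [SMulCommClass k B B]
    {f g : A →ₙₐ[k] B} (h : ∀ x, f x - g x ∈ centerSubmodule k B) {x : A}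
    (hx : x ∈ derivedSubmodule k A) : f x = g x := by
  have hle : derivedSubmodule k A ≤ LinearMap.eqLocus (f : A →ₗ[k] B) (g : A →ₗ[k] B) := by
    refine Submodule.span_le.2 ?_
    rintro z ⟨x, y, rfl⟩
    change f (x * y) = g (x * y)
    -- Replace one factor at a time: `f x * f y = g x * f y = g x * g y`.
    have h₁ := (h x (f y)).1
    have h₂ := (h y (g x)).2
    rw [sub_mul, sub_eq_zero] at h₁
    rw [mul_sub, sub_eq_zero] at h₂
    rw [map_mul, map_mul, h₁, h₂]
  exact hle hx

/-- A homomorphism that is surjective modulo a central subspace is surjective on derived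
algebras. -/
theorem exists_mem_derived_of_surjective_mod_center [IsScalarTower k B B] [SMulCommClass k B B]
    {f : A →ₙₐ[k] B} (h : ∀ b, ∃ a, b - f a ∈ centerSubmodule k B) {b : B}
    (hb : b ∈ derivedSubmodule k B) : ∃ a ∈ derivedSubmodule k A, f a = b := by
  have hle : derivedSubmodule k B ≤ (derivedSubmodule k A).map (f : A →ₗ[k] B) := by
    refine Submodule.span_le.2 ?_
    rintro z ⟨x, y, rfl⟩
    obtain ⟨a, ha⟩ := h x
    obtain ⟨c, hc⟩ := h y
    refine ⟨a * c, Submodule.subset_span ⟨a, c, rfl⟩, ?_⟩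
    have h₁ := (ha y).1
    have h₂ := (hc (f a)).2
    rw [sub_mul, sub_eq_zero] at h₁
    rw [mul_sub, sub_eq_zero] at h₂
    change f (a * c) = x * y
    rw [map_mul, h₁, h₂]
  exact hle hb

/-- An endomorphism of a presentation moves elements of `F'` only by `FR + RF`. -/
theorem sub_mem_presComm_of_mem_derived {π : A →ₙₐ[k] B} {f : A →ₙₐ[k] A}
    (h : ∀ x, π (f x) = π x) {x : A} (hx : x ∈ derivedSubmodule k A) :
    f x - x ∈ presComm π := by
  have hR : ∀ x, f x - x ∈ presKer π := fun x => by
    change π (f x - x) = 0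
    rw [map_sub, h, sub_self]
  have hle : derivedSubmodule k A ≤
      (presComm π).comap ((f : A →ₗ[k] A) - LinearMap.id) := by
    refine Submodule.span_le.2 ?_
    rintro z ⟨x, y, rfl⟩
    change f (x * y) - x * y ∈ presComm π
    -- Each summand has a factor in `R`.
    have : f (x * y) - x * y = f x * (f y - y) + (f x - x) * y := by
      rw [map_mul, mul_sub, sub_mul]; abel
    rw [this]
    exact add_mem (Submodule.subset_span ⟨_, _, hR y, Or.inl rfl⟩)
      (Submodule.subset_span ⟨_, _, hR x, Or.inr rfl⟩)
  exact hle hx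

end Homomorphisms

/-! ### Exactness of the sequence for free presentations -/

section StallingsSequence

variable {k : Type*} [Field k]
variable {L : Type*} [NonUnitalNonAssocRing L] [Module k L]

theorem exact_centralToAb_abToQuot (Z : AlgIdeal k L) :
    Function.Exact (centralToAb Z) (abToQuot Z) := by
  intro y
  obtain ⟨y, rfl⟩ := Submodule.mkQ_surjective _ y
  constructor
  · intro hy
    have hy' : y ∈ Z.toSubmodule ⊔ derivedSubmodule k L :=
      (Submodule.Quotient.mk_eq_zero _).1 hy
    obtain ⟨z, hz, d, hd, rfl⟩ := Submodule.mem_sup.1 hy'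
    refine ⟨⟨z, hz⟩, (Submodule.Quotient.eq _).2 ?_⟩
    simpa using hd
  · rintro ⟨z, hz⟩
    rw [← hz]
    exact (Submodule.Quotient.mk_eq_zero _).2 (Submodule.mem_sup_left z.2)

theorem abToQuot_surjective (Z : AlgIdeal k L) : Function.Surjective (abToQuot Z) :=
  Submodule.factor_surjective le_sup_right

variable [IsScalarTower k L L] [SMulCommClass k L L]

theorem exact_presConnecting_centralToAb {F : Type*} [NonUnitalNonAssocRing F] [Module k F]
    (Z : AlgIdeal k L) (hZ : Z.toSubmodule ≤ centerSubmodule k L)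
    (π : F →ₙₐ[k] Z.Quotient) (hπ : Function.Surjective π)
    (ψ : F →ₙₐ[k] L) (hψ : ∀ x, Z.proj (ψ x) = π x) :
    Function.Exact (presConnecting Z hZ π ψ hψ) (centralToAb Z) := by
  rintro ⟨z, hz⟩
  constructor
  · intro h
    have hz' : z ∈ derivedSubmodule k L := (Submodule.Quotient.mk_eq_zero _).1 h
    -- `π` is onto, so `ψ` is onto modulo the central `Z`; thus `z` lifts to `F'`, and the lift lies
    -- in `ker π` because `z ∈ Z`.
    obtain ⟨x, hx, rfl⟩ := exists_mem_derived_of_surjective_mod_center (f := ψ) (fun b => by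
      obtain ⟨a, ha⟩ := hπ (Z.proj b)
      exact ⟨a, hZ (Z.proj_eq_iff.1 (by rw [hψ, ha]))⟩) hz'
    have hx' : x ∈ presKer π := (hψ x).symm.trans (Z.proj_eq_zero_iff.2 hz)
    exact ⟨Submodule.Quotient.mk ⟨x, hx, hx'⟩, Subtype.ext (presConnecting_mk Z hZ π ψ hψ _)⟩
  · rintro ⟨m, hm⟩
    obtain ⟨x, rfl⟩ := Submodule.Quotient.mk_surjective _ m
    have hx : ψ x = z := (presConnecting_mk Z hZ π ψ hψ x).symm.trans (congrArg Subtype.val hm)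
    refine (Submodule.Quotient.mk_eq_zero _).2 ?_
    change z ∈ derivedSubmodule k L
    rw [← hx]
    exact map_mem_derived ψ x.2.1

theorem exact_presMultiplierMap_presConnecting {F : Type*} [NonUnitalNonAssocRing F] [Module k F]
    [IsScalarTower k F F] [SMulCommClass k F F] [IsLeibniz F] {X : Type*}
    (Z : AlgIdeal k L) (hZ : Z.toSubmodule ≤ centerSubmodule k L)
    (π₁ : F →ₙₐ[k] L) (hπ₁ : Function.Surjective π₁)
    (π₂ : FreeLeibniz k X →ₙₐ[k] Z.Quotient)
    (φ : F →ₙₐ[k] FreeLeibniz k X) (hφ : ∀ x, π₂ (φ x) = Z.proj (π₁ x))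
    (ψ : FreeLeibniz k X →ₙₐ[k] L) (hψ : ∀ x, Z.proj (ψ x) = π₂ x) :
    Function.Exact (presMultiplierMap π₁ π₂ Z.proj φ hφ) (presConnecting Z hZ π₂ ψ hψ) := by
  intro m
  constructor
  · obtain ⟨x, rfl⟩ := Submodule.Quotient.mk_surjective _ m
    intro h
    have hx : ψ x = 0 := (presConnecting_mk Z hZ π₂ ψ hψ x).symm.trans (congrArg Subtype.val h)
    -- Lifting `ψ` through `π₁` yields a backward map of presentations; `ψ x = 0` puts `χ x` in
    -- `R₁`.
    obtain ⟨χ, hχ⟩ := FreeLeibniz.exists_lift π₁ hπ₁ ψ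
    refine ⟨Submodule.Quotient.mk ⟨χ x, map_mem_derived χ x.2.1, (hχ x).trans hx⟩, ?_⟩
    rw [presMultiplierMap_mk, Submodule.Quotient.eq]
    exact sub_mem_presComm_of_mem_derived (π := π₂) (f := φ.comp χ)
      (fun y => by rw [NonUnitalAlgHom.comp_apply, hφ, hχ, hψ]) x.2.1
  · rintro ⟨y, rfl⟩
    obtain ⟨y, rfl⟩ := Submodule.Quotient.mk_surjective _ y
    rw [presMultiplierMap_mk]
    refine Subtype.ext ((presConnecting_mk Z hZ π₂ ψ hψ _).trans ?_)
    have h : ψ.comp φ y = π₁ y := eq_on_derived_of_sub_mem_center (fun x => hZ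
      (Z.proj_eq_iff.1 (by rw [NonUnitalAlgHom.comp_apply, hψ, hφ]))) y.2.1
    exact h.trans y.2.2

end StallingsSequence

/-! ### Maximal defining pairs and the multiplier -/

section Covers

open Cardinal

variable {k : Type*} [Field k]

/-- In a defining pair `(K, M)` of `L`, the ideal `M` is an image of the multiplier computed from
any free presentation of `L`. -/
theorem IsDefiningPair.exists_surjective_presMultiplier
    {L : Type*} [NonUnitalNonAssocRing L] [Module k L] [IsScalarTower k L L] [SMulCommClass k L L]
    {K : Type*} [NonUnitalNonAssocRing K] [Module k K] [IsScalarTower k K K]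
    [SMulCommClass k K K] [IsLeibniz K] {M : AlgIdeal k K} (h : IsDefiningPair L K M)
    {X : Type*} (π : FreeLeibniz k X →ₙₐ[k] L) (hπ : Function.Surjective π) :
    ∃ f : PresMultiplier π →ₗ[k] ↥M.toSubmodule, Function.Surjective f := by
  obtain ⟨⟨e, he⟩, hM⟩ := h
  have hMZ := hM.trans inf_le_left
  -- A lift of `π` to `K` takes `R` into `M`, and centrality of `M` kills `FR + RF`.
  obtain ⟨σ, hσ⟩ := FreeLeibniz.exists_lift (e.comp M.proj)
    (he.2.comp M.proj_surjective) π
  have hker : ∀ x ∈ presKer π, σ x ∈ M.toSubmodule := fun x hx => by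
    refine M.proj_eq_zero_iff.1 (he.1 ?_)
    rw [map_zero]
    exact (hσ x).trans hx
  have hC : presComm π ≤ LinearMap.ker (σ : FreeLeibniz k X →ₗ[k] K) := by
    refine Submodule.span_le.2 ?_
    rintro z ⟨x, r, hr, hz⟩
    have hc := hMZ (hker r hr) (σ x)
    change σ z = 0
    rcases hz with rfl | rfl
    · rw [map_mul]; exact hc.2
    · rw [map_mul]; exact hc.1
  refine ⟨Submodule.liftQ _ ((σ : FreeLeibniz k X →ₗ[k] K).restrict (p := presNum π)
    (q := M.toSubmodule) fun x hx => hker x hx.2) fun x hx => Subtype.ext (hC hx), ?_⟩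
  rintro ⟨m, hm⟩
  obtain ⟨x, hx, rfl⟩ := exists_mem_derived_of_surjective_mod_center (f := σ) (fun b => by
    obtain ⟨a, ha⟩ := hπ (e (M.proj b))
    exact ⟨a, hMZ (M.proj_eq_iff.1 (he.1 ((ha.symm.trans (hσ a).symm))))⟩) (hM hm).2
  have hx' : x ∈ presKer π := by
    change π x = 0
    rw [← hσ, NonUnitalAlgHom.comp_apply, M.proj_eq_zero_iff.2 hm, map_zero]
  exact ⟨Submodule.Quotient.mk ⟨x, hx, hx'⟩, rfl⟩

/-- There is a subspace `S` of `R` complementary to `F' ∩ R` modulo `FR + RF`. -/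
theorem exists_complement_presNum {F : Type*} [NonUnitalNonAssocRing F] [Module k F]
    {L : Type*} [NonUnitalNonAssocRing L] [Module k L] (π : F →ₙₐ[k] L) :
    ∃ S : Submodule k F, presNum π ⊓ S = presComm π ∧ presNum π ⊔ S = presKer π := by
  obtain ⟨T, hT⟩ := exists_isCompl (presNum π)
  have hCN := presComm_le_presNum π
  have hNR : presNum π ≤ presKer π := inf_le_right
  -- `T ⊓ presKer π` complements `F' ∩ R` inside `R`; both identities then follow from the modular
  -- law.
  refine ⟨presComm π ⊔ T ⊓ presKer π, ?_, ?_⟩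
  · rw [inf_comm, sup_inf_assoc_of_le _ hCN, inf_right_comm, inf_comm T, hT.inf_eq_bot, bot_inf_eq,
      sup_bot_eq]
  · rw [← sup_assoc, sup_eq_left.2 hCN, ← sup_inf_assoc_of_le _ hNR, hT.sup_eq_top, top_inf_eq]

/-- Every presentation of `L` yields a defining pair of `L` into whose ideal the multiplier
embeds. -/
theorem exists_isDefiningPair_injective_presMultiplier
    {F : Type*} [NonUnitalNonAssocRing F] [Module k F] [IsScalarTower k F F]
    [SMulCommClass k F F] [IsLeibniz F]
    {L : Type*} [NonUnitalNonAssocRing L] [Module k L]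
    (π : F →ₙₐ[k] L) (hπ : Function.Surjective π) :
    ∃ (S : AlgIdeal k F) (M : AlgIdeal k S.Quotient), IsDefiningPair L S.Quotient M ∧
      ∃ f : PresMultiplier π →ₗ[k] ↥M.toSubmodule, Function.Injective f := by
  obtain ⟨S₀, hinf, hsup⟩ := exists_complement_presNum π
  have hSR : S₀ ≤ presKer π := hsup ▸ le_sup_right
  have hCS : presComm π ≤ S₀ := hinf ▸ inf_le_right
  -- Any subspace between `FR + RF` and `R` is an ideal.
  let S : AlgIdeal k F :=
    { S₀ with
      mul_mem_left' := fun a x hx =>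
        hCS (Submodule.subset_span ⟨a, x, hSR hx, Or.inl rfl⟩)
      mul_mem_right' := fun a x hx =>
        hCS (Submodule.subset_span ⟨a, x, hSR hx, Or.inr rfl⟩) }
  obtain ⟨g, hg⟩ := S.exists_lift π fun x hx => hSR hx
  obtain ⟨e, he⟩ := (AlgIdeal.ker g).exists_lift g fun x hx => hx
  refine ⟨S, AlgIdeal.ker g, ⟨⟨e, ?_, ?_⟩, ?_⟩, ?_⟩
  · intro a b hab
    obtain ⟨a, rfl⟩ := AlgIdeal.proj_surjective _ a
    obtain ⟨b, rfl⟩ := AlgIdeal.proj_surjective _ b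
    rw [he, he] at hab
    rw [AlgIdeal.proj_eq_iff, AlgIdeal.mem_ker, map_sub, hab, sub_self]
  · intro y
    obtain ⟨x, rfl⟩ := hπ y
    exact ⟨_, (he _).trans (hg x)⟩
  · intro m hm
    obtain ⟨x, rfl⟩ := S.proj_surjective m
    have hx : x ∈ presKer π := (hg x).symm.trans hm
    constructor
    · intro y
      obtain ⟨y, rfl⟩ := S.proj_surjective y
      rw [← map_mul, ← map_mul, S.proj_eq_zero_iff, S.proj_eq_zero_iff]
      exact ⟨hCS (Submodule.subset_span ⟨y, x, hx, Or.inr rfl⟩),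
        hCS (Submodule.subset_span ⟨y, x, hx, Or.inl rfl⟩)⟩
    -- As `R = (F' ∩ R) + S`, each element of `R/S` has a representative in `F'`.
    · rw [← hsup] at hx
      obtain ⟨n, hn, s, hs, rfl⟩ := Submodule.mem_sup.1 hx
      rw [map_add, S.proj_eq_zero_iff.2 hs, add_zero]
      exact map_mem_derived S.proj hn.1
  · refine ⟨Submodule.liftQ _ ((S.proj : F →ₗ[k] S.Quotient).restrict (p := presNum π)
      (q := (AlgIdeal.ker g).toSubmodule) fun x hx => (hg x).trans hx.2) ?_, ?_⟩
    · exact fun x hx => Subtype.ext (S.proj_eq_zero_iff.2 (hCS hx))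
    · rw [← LinearMap.ker_eq_bot, Submodule.ker_liftQ_eq_bot']
      refine le_antisymm ?_ ?_
      · exact fun x hx => Subtype.ext (S.proj_eq_zero_iff.2 (hCS hx))
      · intro x hx
        have hx' : (x : F) ∈ S₀ := S.proj_eq_zero_iff.1 (congrArg Subtype.val hx)
        change (x : F) ∈ presComm π
        rw [← hinf]
        exact ⟨x.2, hx'⟩

/-- For a defining pair `(K, M)` of `L`, `dim K = dim L + dim M`. -/
theorem IsDefiningPair.lift_rank_eq
    {L : Type v} [NonUnitalNonAssocRing L] [Module k L]
    {K : Type u} [NonUnitalNonAssocRing K] [Module k K] [IsScalarTower k K K]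
    [SMulCommClass k K K] [IsLeibniz K] {M : AlgIdeal k K} (h : IsDefiningPair L K M) :
    lift.{v} (Module.rank k K) =
      lift.{u} (Module.rank k L) + lift.{v} (Module.rank k ↥M.toSubmodule) := by
  obtain ⟨⟨e, he⟩, -⟩ := h
  have hker : LinearMap.ker ((e.comp M.proj : K →ₙₐ[k] L) : K →ₗ[k] L) = M.toSubmodule := by
    ext x
    rw [← M.proj_eq_zero_iff, ← map_eq_zero_iff e he.1]
    rfl
  rw [← hker]
  exact LinearMap.lift_rank_eq_of_surjective (he.2.comp M.proj_surjective)

/-- The ideal of a maximal defining pair of a finite-dimensional algebra `L` is isomorphic to the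
multiplier computed from any free presentation of `L`. -/
theorem IsMaximalDefiningPair.nonempty_equiv_presMultiplier {k : Type u} [Field k]
    {L : Type v} [NonUnitalNonAssocRing L] [Module k L] [IsScalarTower k L L] [SMulCommClass k L L]
    [IsLeibniz L] [FiniteDimensional k L]
    {K : Type (max u v)} [NonUnitalNonAssocRing K] [Module k K] [IsScalarTower k K K]
    [SMulCommClass k K K] [IsLeibniz K] {M : AlgIdeal k K} (h : IsMaximalDefiningPair L K M)
    {X : Type*} (π : FreeLeibniz k X →ₙₐ[k] L) (hπ : Function.Surjective π) :
    Nonempty (↥M.toSubmodule ≃ₗ[k] PresMultiplier π) := by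
  obtain ⟨f, hf⟩ := IsDefiningPair.exists_surjective_presMultiplier h.1 π hπ
  -- Maximality only compares algebras in `Type (max u v)`, whereas `X` may live elsewhere; the
  -- presentation on the set `L` itself has the right universe.
  obtain ⟨p, hp⟩ := FreeLeibniz.exists_presentation (k := k) (L := L)
  obtain ⟨S₁, N₁, hN₁, g₁, hg₁⟩ := exists_isDefiningPair_injective_presMultiplier π hπ
  obtain ⟨g₂, hg₂⟩ := hN₁.exists_surjective_presMultiplier p hp
  obtain ⟨S₂, N₂, hN₂, g₃, hg₃⟩ := exists_isDefiningPair_injective_presMultiplier p hp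
  have hNM : Module.rank k ↥N₂.toSubmodule ≤ Module.rank k ↥M.toSubmodule := by
    have hle := lift_le.{v}.2 (h.2 S₂.Quotient N₂ hN₂)
    rw [IsDefiningPair.lift_rank_eq h.1, hN₂.lift_rank_eq, add_comm, add_comm (lift (Module.rank k L)),
      add_le_add_iff_of_lt_aleph0 (lift_lt_aleph0.2 (Module.rank_lt_aleph0 k L))] at hle
    exact lift_le.1 hle
  refine Module.nonempty_linearEquiv_iff_lift_rank_eq.2 (le_antisymm ?_ ?_)
  -- Both inequalities are between cardinals, so finiteness of the multiplier is not needed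
  -- beforehand.
  · exact LinearMap.lift_rank_le_of_surjective f hf
  · calc
      _ ≤ _ := lift_le.2 (LinearMap.rank_le_of_injective g₁ hg₁)
      _ ≤ _ := LinearMap.lift_rank_le_of_surjective g₂ hg₂
      _ ≤ _ := lift_le.2 ((LinearMap.rank_le_of_injective g₃ hg₃).trans hNM)

end Covers

/-! ### The Stallings sequence -/

theorem mainTheorem7 {k : Type u} [Field k]
    {L : Type v} [NonUnitalNonAssocRing L] [Module k L] [IsScalarTower k L L]
    [SMulCommClass k L L] [IsLeibniz L]
    (Z : AlgIdeal k L) (hZ : Z.toSubmodule ≤ centerSubmodule k L)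
    -- arbitrary free presentations of `L` and of `L/Z`
    {X₁ X₂ : Type*}
    (π₁ : FreeLeibniz k X₁ →ₙₐ[k] L) (hπ₁ : Function.Surjective π₁)
    (π₂ : FreeLeibniz k X₂ →ₙₐ[k] Z.Quotient) (hπ₂ : Function.Surjective π₂)
    -- arbitrary lifts of the projection `L → L/Z` and of `π₂` (they exist by freeness)
    (φ : FreeLeibniz k X₁ →ₙₐ[k] FreeLeibniz k X₂) (hφ : ∀ x, π₂ (φ x) = Z.proj (π₁ x))
    (ψ : FreeLeibniz k X₂ →ₙₐ[k] L) (hψ : ∀ x, Z.proj (ψ x) = π₂ x) :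
    -- exactness of `M(L) → M(L/Z) → Z → L/L' → L/(Z+L') → 0`
    (Function.Exact (presMultiplierMap π₁ π₂ Z.proj φ hφ) (presConnecting Z hZ π₂ ψ hψ) ∧
      Function.Exact (presConnecting Z hZ π₂ ψ hψ) (centralToAb Z) ∧
      Function.Exact (centralToAb Z) (abToQuot Z) ∧
      Function.Surjective (abToQuot Z)) ∧
    -- the same with the multipliers taken from maximal defining pairs, for `L` finite-dimensional
    (FiniteDimensional k L →
      ∀ (K₁ : Type (max u v)) [NonUnitalNonAssocRing K₁] [Module k K₁] [IsScalarTower k K₁ K₁]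
        [SMulCommClass k K₁ K₁] [IsLeibniz K₁] (M₁ : AlgIdeal k K₁)
        (K₂ : Type (max u v)) [NonUnitalNonAssocRing K₂] [Module k K₂] [IsScalarTower k K₂ K₂]
        [SMulCommClass k K₂ K₂] [IsLeibniz K₂] (M₂ : AlgIdeal k K₂),
        IsMaximalDefiningPair L K₁ M₁ → IsMaximalDefiningPair Z.Quotient K₂ M₂ →
        ∃ (e₁ : ↥M₁.toSubmodule ≃ₗ[k] PresMultiplier π₁)
          (e₂ : ↥M₂.toSubmodule ≃ₗ[k] PresMultiplier π₂)
          (β : ↥M₁.toSubmodule →ₗ[k] ↥M₂.toSubmodule)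
          (θ : ↥M₂.toSubmodule →ₗ[k] ↥Z.toSubmodule),
          (∀ m, e₂ (β m) = presMultiplierMap π₁ π₂ Z.proj φ hφ (e₁ m)) ∧
          (∀ m, θ m = presConnecting Z hZ π₂ ψ hψ (e₂ m)) ∧
          Function.Exact β θ ∧
          Function.Exact θ (centralToAb Z) ∧
          Function.Exact (centralToAb Z) (abToQuot Z) ∧
          Function.Surjective (abToQuot Z)) := by
  have hexact := exact_presMultiplierMap_presConnecting Z hZ π₁ hπ₁ π₂ φ hφ ψ hψ
  have hexact' := exact_presConnecting_centralToAb Z hZ π₂ hπ₂ ψ hψ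
  refine ⟨⟨hexact, hexact', exact_centralToAb_abToQuot Z, abToQuot_surjective Z⟩, ?_⟩
  intro _ K₁ _ _ _ _ _ M₁ K₂ _ _ _ _ _ M₂ h₁ h₂
  have : FiniteDimensional k Z.Quotient :=
    inferInstanceAs (FiniteDimensional k (L ⧸ Z.toSubmodule))
  obtain ⟨e₁⟩ := h₁.nonempty_equiv_presMultiplier π₁ hπ₁
  obtain ⟨e₂⟩ := h₂.nonempty_equiv_presMultiplier π₂ hπ₂
  -- `β` and `θ` are defined by conjugation, so both squares commute by construction and exactness
  -- transfers.
  refine ⟨e₁, e₂, e₂.symm.toLinearMap ∘ₗ presMultiplierMap π₁ π₂ Z.proj φ hφ ∘ₗ e₁.toLinearMap,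
    presConnecting Z hZ π₂ ψ hψ ∘ₗ e₂.toLinearMap, fun m => by simp, fun m => rfl, ?_, ?_,
    exact_centralToAb_abToQuot Z, abToQuot_surjective Z⟩
  · intro y
    refine (hexact (e₂ y)).trans ⟨?_, ?_⟩
    · rintro ⟨x, hx⟩
      exact ⟨e₁.symm x, by simp [hx]⟩
    · rintro ⟨x, rfl⟩
      exact ⟨e₁ x, by simp⟩
  · intro z
    refine (hexact' z).trans ⟨?_, ?_⟩
    · rintro ⟨x, rfl⟩
      exact ⟨e₂.symm x, by simp⟩
    · rintro ⟨x, rfl⟩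
      exact ⟨e₂ x, rfl⟩
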